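/- Let $D$ be an integral domain with quotient field $K$, and let $\mathbf{F}(D)$ be the set of $D$-submodules of $K$. A semistar operation on $D$ is a map $\star:\mathbf{F}(D)\to\mathbf{F}(D)$, $I\mapsto I^\star$, such that $I\subseteq I^\star$, $I\subseteq J$ implies $I^\star\subseteq J^\star$, $(I^\star)^\star=I^\star$ and $(xI)^\star=x\,I^\star$ for all $I,J\in\mathbf{F}(D)$ and $x\in K$. It is stable if $(I\cap J)^\star=I^\star\cap J^\star$ for all $I,J\in\mathbf{F}(D)$; it is radical if it is stable and, for every ideal $I$ of $D$, $1\notin I^\star$ implies $1\notin\operatorname{rad}(I)^\star$; it is spectral if there is a set $\Delta\subseteq\operatorname{Spec}(D)$ such that $I^\star=\bigcap_{P\in\Delta}ID_P$ for all $I\in\mathbf{F}(D)$. For a semistar operation $\star$, let $\operatorname{QSpec}^\star(D)$ be the set of prime ideals $P$ with $P=P^\star\cap D$, and let $\operatorname{PsSpec}^\star(D)$ be the set of prime ideals $Q$ such that $1\in Q^\star$ but $L=L^\star\cap D$ for some $Q$-primary ideal $L$. If $D$ is a Prüfer domain (every nonzero finitely generated ideal is invertible), the normalized stable version of $\star$ is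 the map $$\widehat{\star}: I\mapsto\bigcap_{P\in\operatorname{QSpec}^\star(D)}ID_P\;\cap\bigcap_{Q\in\operatorname{PsSpec}^\star(D)}(ID_Q)^{v_Q},$$ where $J^{v_Q}=(D_Q:(D_Q:J))$ and $(D_Q:J)=\{x\in K\mid xJ\subseteq D_Q\}$. Suppose that $\operatorname{Spec}(D)$ is countable (finite or countably infinite). Then every radical semistar operation on $D$ is spectral. If moreover $D$ is a Prüfer domain, then $\star=\widehat{\star}$ for every stable semistar operation $\star$ on $D$. -/

import Mathlib

open scoped Pointwise nonZeroDivisors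

universe u v

/-- A semistar operation on the domain `D` with quotient field `K`: an extensive, monotone,
idempotent self-map of the set of `D`-submodules of `K` that commutes with multiplication by
elements of `K`. Here `x • I` is the submodule `{x * y | y ∈ I}`. -/
structure SemistarOperation (D : Type u) [CommRing D] [IsDomain D]
    (K : Type v) [Field K] [Algebra D K] [IsFractionRing D K] where
  toFun : Submodule D K → Submodule D K
  le_closure' : ∀ I, I ≤ toFun I
  monotone' : ∀ I J, I ≤ J → toFun I ≤ toFun J
  idempotent' : ∀ I, toFun (toFun I) = toFun I
  smul' : ∀ (x : K) (I : Submodule D K), toFun (x • I) = x • toFun I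

/-- A Prüfer domain: every nonzero finitely generated ideal is invertible. -/
def IsPruferDomain (D : Type u) [CommRing D] [IsDomain D] : Prop :=
  ∀ I : Ideal D, I.FG → I ≠ ⊥ → IsUnit (I : FractionalIdeal D⁰ (FractionRing D))

namespace SemistarOperation

variable {D : Type u} [CommRing D] [IsDomain D]
  {K : Type v} [Field K] [Algebra D K] [IsFractionRing D K]

instance : CoeFun (SemistarOperation D K) (fun _ => Submodule D K → Submodule D K) :=
  ⟨toFun⟩

/-- An ideal `I` of `D`, regarded as a `D`-submodule of `K`. -/
def ofIdeal (K : Type v) [Field K] [Algebra D K] (I : Ideal D) : Submodule D K :=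
  Submodule.map (Algebra.linearMap D K) I

/-- The ideal `M ∩ D` of `D`, for a `D`-submodule `M` of `K`. -/
def contract (M : Submodule D K) : Ideal D :=
  Submodule.comap (Algebra.linearMap D K) M

/-- The localization `D_P`, as a `D`-submodule of `K`: its elements are the fractions `a / s`
with `a ∈ D` and `s ∈ D \ P`. -/
noncomputable def locAt (K : Type v) [Field K] [Algebra D K] [IsFractionRing D K]
    (P : PrimeSpectrum D) : Submodule D K :=
  Subalgebra.toSubmodule (Localization.subalgebra.ofField K P.asIdeal.primeCompl
    P.asIdeal.primeCompl_le_nonZeroDivisors)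

/-- The extension `I D_P` of a `D`-submodule `I` of `K`. -/
noncomputable def extendAt (P : PrimeSpectrum D) (I : Submodule D K) : Submodule D K :=
  I * locAt K P

/-- The divisorial closure `(T : (T : I))`, where `(T : I) = {x ∈ K | x I ⊆ T}`; this is
the `v`-operation of `T` when `T` is an overring and `I` is a `T`-submodule of `K`. -/
def divisorialClosure (T I : Submodule D K) : Submodule D K :=
  T / (T / I)

/-- The map `s_Δ`, sending `I` to the intersection of the `I D_P` for `P ∈ Δ`. -/
noncomputable def spectralMap (Δ : Set (PrimeSpectrum D)) (I : Submodule D K) :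
    Submodule D K :=
  ⨅ P ∈ Δ, extendAt P I

/-- A semistar operation is spectral if it equals `s_Δ` for some set `Δ` of primes. -/
def IsSpectral (star : SemistarOperation D K) : Prop :=
  ∃ Δ : Set (PrimeSpectrum D), ∀ I : Submodule D K, star I = spectralMap Δ I

/-- A semistar operation is stable if it distributes over finite intersections. -/
def IsStable (star : SemistarOperation D K) : Prop :=
  ∀ I J : Submodule D K, star (I ⊓ J) = star I ⊓ star J

/-- Quasi-radical: if `1 ∉ I^⋆` for an ideal `I` of `D`, then `1 ∉ rad(I)^⋆`. -/
def IsQuasiRadical (star : SemistarOperation D K) : Prop :=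
  ∀ I : Ideal D, (1 : K) ∉ star (ofIdeal K I) → (1 : K) ∉ star (ofIdeal K I.radical)

/-- Radical: quasi-radical and stable. -/
def IsRadical (star : SemistarOperation D K) : Prop :=
  star.IsQuasiRadical ∧ star.IsStable

/-- `I` is a quasi-`⋆`-ideal: `I = I^⋆ ∩ D`. -/
def IsQuasiIdeal (star : SemistarOperation D K) (I : Ideal D) : Prop :=
  I = contract (star (ofIdeal K I))

/-- The quasi-spectrum: the set of prime quasi-`⋆`-ideals. -/
def quasiSpec (star : SemistarOperation D K) : Set (PrimeSpectrum D) :=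
  {P | star.IsQuasiIdeal P.asIdeal}

/-- The pseudo-spectrum: the primes `Q` with `1 ∈ Q^⋆` such that some `Q`-primary ideal is a
quasi-`⋆`-ideal. -/
def pseudoSpec (star : SemistarOperation D K) : Set (PrimeSpectrum D) :=
  {Q | (1 : K) ∈ star (ofIdeal K Q.asIdeal) ∧
    ∃ L : Ideal D, L.IsPrimary ∧ L.radical = Q.asIdeal ∧ star.IsQuasiIdeal L}

/-- The normalized stable version of `⋆`: the intersection of the `I D_P` for `P` in the
quasi-spectrum and of the `v`-closures of `I D_Q` with respect to `D_Q`, for `Q` in the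
pseudo-spectrum. -/
noncomputable def normalizedStable (star : SemistarOperation D K) (I : Submodule D K) :
    Submodule D K :=
  (⨅ P ∈ star.quasiSpec, extendAt P I) ⊓
    ⨅ Q ∈ star.pseudoSpec, divisorialClosure (locAt K Q) (extendAt Q I)

end SemistarOperation

/-! Write `F` for the ideals `A` with `1 ∈ A^⋆`. Stability makes `⋆` determined by `F`: `x ∈ I^⋆`
iff `(I : x) ∈ F` (`mem_star_iff`), and a prime is quasi-`⋆` iff it is not in `F`. Countability
enters through a diagonal choice (`exists_seq_prod_notMem`), run along an enumeration of the primes.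
A radical ideal outside `F` then lies in a quasi-`⋆` prime, which gives spectrality. Any ideal `A`
outside `F` has `A D_P ∩ D` outside `F` for some prime `P ⊇ A`. In the Prüfer case take `A = (I :
x)` and a minimal prime `Q ⊆ P` of `A`. Either `Q ∉ F` and `x ∉ I D_Q`, or `Q ∈ F`, and then `A D_Q
∩ D` stays outside `F`, `Q` is in the pseudo-spectrum, and `x` is missed by the `v`-closure of `I
D_Q`. -/

set_option linter.unusedSectionVars false

namespace SemistarOperation

/-! ### Localizations, conductors and saturations -/

section Submodules

variable {D : Type u} [CommRing D] [IsDomain D]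
  {K : Type v} [Field K] [Algebra D K] [IsFractionRing D K]

theorem mem_contract {M : Submodule D K} {d : D} : d ∈ contract M ↔ algebraMap D K d ∈ M :=
  Iff.rfl

theorem algebraMap_mem_ofIdeal {A : Ideal D} {d : D} :
    algebraMap D K d ∈ ofIdeal K A ↔ d ∈ A := by
  constructor
  · rintro ⟨a, ha, h⟩
    rwa [← IsFractionRing.injective D K h]
  · exact fun h => ⟨d, h, rfl⟩

theorem ofIdeal_mono {A B : Ideal D} (h : A ≤ B) : ofIdeal K A ≤ ofIdeal K B :=
  Submodule.map_mono h

theorem one_mem_ofIdeal_top : (1 : K) ∈ ofIdeal K (⊤ : Ideal D) :=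
  ⟨1, trivial, by simp⟩

theorem mem_locAt {P : PrimeSpectrum D} {x : K} :
    x ∈ locAt K P ↔ ∃ s ∉ P.asIdeal, ∃ a : D, s • x = algebraMap D K a := by
  constructor
  · rintro ⟨a, s, hs, rfl⟩
    have hs0 : algebraMap D K s ≠ 0 := by
      rw [Ne, FaithfulSMul.algebraMap_eq_zero_iff]
      rintro rfl
      exact hs (zero_mem _)
    refine ⟨s, hs, a, ?_⟩
    rw [Algebra.smul_def]
    field_simp
  · rintro ⟨s, hs, a, h⟩
    have hs0 : algebraMap D K s ≠ 0 := by
      rw [Ne, FaithfulSMul.algebraMap_eq_zero_iff]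
      rintro rfl
      exact hs (zero_mem _)
    refine ⟨a, s, hs, ?_⟩
    rw [← h, Algebra.smul_def]
    field_simp

theorem mem_extendAt {P : PrimeSpectrum D} {I : Submodule D K} {x : K} :
    x ∈ extendAt P I ↔ ∃ s ∉ P.asIdeal, s • x ∈ I := by
  constructor
  · intro h
    refine Submodule.mul_induction_on h (fun m hm n hn => ?_) fun x y hx hy => ?_
    · obtain ⟨s, hs, a, h⟩ := mem_locAt.1 hn
      refine ⟨s, hs, ?_⟩
      rw [← mul_smul_comm, h, mul_comm, ← Algebra.smul_def]
      exact I.smul_mem a hm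
    · obtain ⟨s, hs, hx⟩ := hx
      obtain ⟨t, ht, hy⟩ := hy
      refine ⟨s * t, P.2.mul_notMem hs ht, ?_⟩
      rw [smul_add]
      refine add_mem ?_ ?_
      · rw [mul_comm, mul_smul]
        exact I.smul_mem t hx
      · rw [mul_smul]
        exact I.smul_mem s hy
  · rintro ⟨s, hs, h⟩
    have hs0 : algebraMap D K s ≠ 0 := by
      rw [Ne, FaithfulSMul.algebraMap_eq_zero_iff]
      rintro rfl
      exact hs (zero_mem _)
    have hloc : (algebraMap D K s)⁻¹ ∈ locAt K P :=
      mem_locAt.2 ⟨s, hs, 1, by rw [Algebra.smul_def, mul_inv_cancel₀ hs0, map_one]⟩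
    have := Submodule.mul_mem_mul h hloc
    rwa [Algebra.smul_def, mul_right_comm, mul_inv_cancel₀ hs0, one_mul] at this

/-- The conductor ideal `{d ∈ D | d x ∈ I}`. -/
def conductor (I : Submodule D K) (x : K) : Ideal D :=
  I.comap (LinearMap.toSpanSingleton D K x)

theorem mem_conductor {I : Submodule D K} {x : K} {d : D} : d ∈ conductor I x ↔ d • x ∈ I :=
  Iff.rfl

theorem mem_conductor_ofIdeal {A : Ideal D} {a d : D} :
    d ∈ conductor (ofIdeal K A) (algebraMap D K a) ↔ d * a ∈ A := by
  rw [mem_conductor, Algebra.smul_def, ← map_mul, algebraMap_mem_ofIdeal]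

theorem mem_extendAt_iff_conductor_not_le {P : PrimeSpectrum D} {I : Submodule D K} {x : K} :
    x ∈ extendAt P I ↔ ¬ conductor I x ≤ P.asIdeal := by
  rw [mem_extendAt, SetLike.not_le_iff_exists]
  exact exists_congr fun s => and_comm

variable (K) in
/-- The saturation `A D_P ∩ D` of the ideal `A` with respect to the prime `P`. -/
noncomputable def saturation (P : PrimeSpectrum D) (A : Ideal D) : Ideal D :=
  contract (extendAt P (ofIdeal K A))

theorem mem_saturation {P : PrimeSpectrum D} {A : Ideal D} {d : D} :
    d ∈ saturation K P A ↔ ∃ s ∉ P.asIdeal, s * d ∈ A := by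
  rw [saturation, mem_contract, mem_extendAt]
  simp_rw [Algebra.smul_def, ← map_mul, algebraMap_mem_ofIdeal]

theorem saturation_eq_top {P : PrimeSpectrum D} {A : Ideal D} (h : ¬ A ≤ P.asIdeal) :
    saturation K P A = ⊤ := by
  obtain ⟨s, hs, hsP⟩ := SetLike.not_le_iff_exists.1 h
  exact (Ideal.eq_top_iff_one _).2 (mem_saturation.2 ⟨s, hsP, by rwa [mul_one]⟩)

theorem isPrimary_of_forall_mul_mem {P : PrimeSpectrum D} {L : Ideal D}
    (hle : L ≤ P.asIdeal) (hrad : P.asIdeal ≤ L.radical)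
    (h : ∀ s ∉ P.asIdeal, ∀ d, s * d ∈ L → d ∈ L) :
    L.IsPrimary ∧ L.radical = P.asIdeal := by
  refine ⟨Ideal.isPrimary_iff.2 ⟨ne_top_of_le_ne_top P.2.ne_top hle, fun {x y} hxy => ?_⟩,
    le_antisymm (P.2.radical_le_iff.2 hle) hrad⟩
  by_cases hy : y ∈ P.asIdeal
  · exact Or.inr (hrad hy)
  · exact Or.inl (h y hy x (by rwa [mul_comm]))

/-- `P D_P` is the only prime of `D_P` over `A D_P`. -/
theorem le_radical_saturation_of_mem_minimalPrimes {P : PrimeSpectrum D} {A : Ideal D}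
    (hP : P.asIdeal ∈ A.minimalPrimes) : P.asIdeal ≤ (saturation K P A).radical := by
  intro q hq
  by_contra hcon
  obtain ⟨N, hN, hAN, hdis⟩ := Ideal.exists_le_prime_disjoint A
    (P.asIdeal.primeCompl ⊔ Submonoid.powers q) <| by
      rw [Set.disjoint_left]
      intro x hx hx'
      obtain ⟨s, hs, _, ⟨n, rfl⟩, rfl⟩ := Submonoid.mem_sup.1 hx'
      exact hcon ⟨n, mem_saturation.2 ⟨s, hs, hx⟩⟩
  rw [Set.disjoint_left] at hdis
  have hNP : N ≤ P.asIdeal := fun d hd => by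
    by_contra hdP
    exact hdis hd (Submonoid.mem_sup_left hdP)
  exact hdis (hP.2 ⟨hN, hAN⟩ hNP hq) (Submonoid.mem_sup_right (Submonoid.mem_powers q))

theorem saturation_mono {P : PrimeSpectrum D} {A B : Ideal D} (h : A ≤ B) :
    saturation K P A ≤ saturation K P B := fun d hd => by
  obtain ⟨s, hs, hsd⟩ := mem_saturation.1 hd
  exact mem_saturation.2 ⟨s, hs, h hsd⟩

theorem saturation_mul_le {P : PrimeSpectrum D} {A B : Ideal D} :
    saturation K P A * saturation K P B ≤ saturation K P (A * B) := by
  rw [Ideal.mul_le]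
  intro a ha b hb
  obtain ⟨s, hs, hsa⟩ := mem_saturation.1 ha
  obtain ⟨t, ht, htb⟩ := mem_saturation.1 hb
  refine mem_saturation.2 ⟨s * t, P.2.mul_notMem hs ht, ?_⟩
  rw [mul_mul_mul_comm]
  exact Ideal.mul_mem_mul hsa htb

theorem saturation_pow_le {P : PrimeSpectrum D} {A : Ideal D} (n : ℕ) :
    saturation K P A ^ n ≤ saturation K P (A ^ n) := by
  induction n with
  | zero =>
    rw [pow_zero, pow_zero, Ideal.one_eq_top,
      saturation_eq_top (fun h => P.2.ne_top (top_le_iff.1 h))]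
  | succ n ih =>
    rw [pow_succ, pow_succ]
    exact (Ideal.mul_mono_left ih).trans saturation_mul_le

theorem saturation_saturation {P : PrimeSpectrum D} {A : Ideal D} {s d : D}
    (hs : s ∉ P.asIdeal) (h : s * d ∈ saturation K P A) : d ∈ saturation K P A := by
  obtain ⟨t, ht, h⟩ := mem_saturation.1 h
  exact mem_saturation.2 ⟨t * s, P.2.mul_notMem ht hs, by rwa [mul_assoc]⟩

theorem mem_locAt_of_smul_eq {P : PrimeSpectrum D} {z : K} {s a : D} (hs : s ∉ P.asIdeal)
    (h : s • z = algebraMap D K a) : z ∈ locAt K P :=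
  mem_locAt.2 ⟨s, hs, a, h⟩

end Submodules

/-! ### Localizing systems and the countability argument -/

section Stable

variable {D : Type u} [CommRing D] [IsDomain D]
  {K : Type v} [Field K] [Algebra D K] [IsFractionRing D K]
  {star : SemistarOperation D K}

/-- The ideals `A` of `D` such that `1 ∈ A^⋆` form the localizing system of `⋆`. -/
def localizingSystem (star : SemistarOperation D K) : Set (Ideal D) :=
  {A | (1 : K) ∈ star (ofIdeal K A)}

theorem localizingSystem_mono {A B : Ideal D} (h : A ≤ B) (hA : A ∈ star.localizingSystem) :
    B ∈ star.localizingSystem :=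
  star.monotone' _ _ (ofIdeal_mono h) hA

theorem top_mem_localizingSystem : (⊤ : Ideal D) ∈ star.localizingSystem :=
  star.le_closure' _ one_mem_ofIdeal_top

theorem mem_star_iff (hst : star.IsStable) {I : Submodule D K} {x : K} :
    x ∈ star I ↔ conductor I x ∈ star.localizingSystem := by
  rcases eq_or_ne x 0 with rfl | hx
  · have : conductor I (0 : K) = ⊤ := by
      ext d
      simp [mem_conductor]
    rw [this]
    exact ⟨fun _ => top_mem_localizingSystem, fun _ => zero_mem _⟩
  -- `(I : x) = x⁻¹ I ∩ D`, so stability and homogeneity compute its closure.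
  · have key : ofIdeal K (conductor I x) = x⁻¹ • I ⊓ ofIdeal K ⊤ := by
      ext y
      rw [Submodule.mem_inf, Submodule.mem_smul_pointwise_iff_exists]
      constructor
      · rintro ⟨d, hd, rfl⟩
        refine ⟨⟨d • x, hd, ?_⟩, ⟨d, trivial, rfl⟩⟩
        rw [smul_eq_mul, Algebra.smul_def, mul_left_comm, inv_mul_cancel₀ hx, mul_one]
        rfl
      · rintro ⟨⟨b, hb, rfl⟩, ⟨d, -, hd⟩⟩
        refine ⟨d, ?_, hd⟩
        change d • x ∈ I
        have hd' : algebraMap D K d = x⁻¹ * b := hd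
        rwa [Algebra.smul_def, hd', mul_comm, mul_inv_cancel_left₀ hx]
    change _ ↔ (1 : K) ∈ star _
    rw [key, hst, star.smul', Submodule.mem_inf, Submodule.mem_smul_pointwise_iff_exists]
    constructor
    · exact fun h => ⟨⟨x, h, inv_mul_cancel₀ hx⟩, top_mem_localizingSystem⟩
    · rintro ⟨⟨b, hb, h⟩, -⟩
      rw [smul_eq_mul, inv_mul_eq_one₀ hx] at h
      rwa [h]

theorem mem_localizingSystem_of_conductor (hst : star.IsStable) {A J : Ideal D}
    (hJ : J ∈ star.localizingSystem)
    (h : ∀ j ∈ J, conductor (ofIdeal K A) (algebraMap D K j) ∈ star.localizingSystem) :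
    A ∈ star.localizingSystem := by
  have hle : ofIdeal K J ≤ star (ofIdeal K A) := by
    rintro _ ⟨j, hj, rfl⟩
    exact (mem_star_iff hst).2 (h j hj)
  have := star.monotone' _ _ hle hJ
  rwa [star.idempotent'] at this

theorem mul_mem_localizingSystem (hst : star.IsStable) {A B : Ideal D}
    (hA : A ∈ star.localizingSystem) (hB : B ∈ star.localizingSystem) :
    A * B ∈ star.localizingSystem := by
  refine mem_localizingSystem_of_conductor hst hA fun a ha => localizingSystem_mono ?_ hB
  intro b hb
  exact mem_conductor_ofIdeal.2 (mul_comm a b ▸ Ideal.mul_mem_mul ha hb)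

theorem pow_mem_localizingSystem (hst : star.IsStable) {A : Ideal D}
    (hA : A ∈ star.localizingSystem) (n : ℕ) : A ^ n ∈ star.localizingSystem := by
  induction n with
  | zero =>
    rw [pow_zero, Ideal.one_eq_top]
    exact top_mem_localizingSystem
  | succ n ih =>
    rw [pow_succ]
    exact mul_mem_localizingSystem hst ih hA

theorem mem_quasiSpec_iff (hst : star.IsStable) {P : PrimeSpectrum D} :
    P ∈ star.quasiSpec ↔ P.asIdeal ∉ star.localizingSystem := by
  constructor
  · intro h hP
    have h' : P.asIdeal = contract (star (ofIdeal K P.asIdeal)) := h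
    refine P.2.ne_top ((Ideal.eq_top_iff_one _).2 ?_)
    rw [h', mem_contract, map_one]
    exact hP
  · intro hP
    refine le_antisymm (fun a ha => star.le_closure' _ (algebraMap_mem_ofIdeal.2 ha)) ?_
    intro a ha
    by_contra haP
    refine hP (localizingSystem_mono (fun d hd => ?_) ((mem_star_iff hst).1 ha))
    exact (P.2.mem_or_mem (mem_conductor_ofIdeal.1 hd)).resolve_right haP

theorem mem_extendAt_of_mem_star (hst : star.IsStable) {P : PrimeSpectrum D}
    (hP : P ∈ star.quasiSpec) {I : Submodule D K} {x : K} (hx : x ∈ star I) :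
    x ∈ extendAt P I :=
  mem_extendAt_iff_conductor_not_le.2 fun hle =>
    (mem_quasiSpec_iff hst).1 hP (localizingSystem_mono hle ((mem_star_iff hst).1 hx))

/-- A diagonal choice: an ideal outside the localizing system avoids all the finite products of
suitably chosen elements of any given sequence of members of the localizing system. -/
theorem exists_seq_prod_notMem (hst : star.IsStable) {A : Ideal D}
    (hA : A ∉ star.localizingSystem) (J : ℕ → Ideal D) (hJ : ∀ n, J n ∈ star.localizingSystem) :
    ∃ j : ℕ → D, (∀ n, j n ∈ J n) ∧ ∀ n, ∏ i ∈ Finset.range n, j i ∉ A := by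
  -- The invariant `(A : p) ∉ F` is stronger than `p ∉ A` and lets the choice continue.
  let T := {p : D // conductor (ofIdeal K A) (algebraMap D K p) ∉ star.localizingSystem}
  have step : ∀ (n : ℕ) (p : T), ∃ j ∈ J n,
      conductor (ofIdeal K A) (algebraMap D K (p.1 * j)) ∉ star.localizingSystem := by
    intro n p
    by_contra! h
    refine p.2 (mem_localizingSystem_of_conductor hst (hJ n) fun j hj =>
      localizingSystem_mono (fun d hd => ?_) (h j hj))
    rw [mem_conductor_ofIdeal] at hd ⊢
    rw [mem_conductor_ofIdeal, mul_assoc, mul_comm j]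
    exact hd
  choose g hg hg' using step
  have h1 : conductor (ofIdeal K A) (algebraMap D K 1) ∉ star.localizingSystem := fun h =>
    hA (localizingSystem_mono (fun d hd => by simpa using mem_conductor_ofIdeal.1 hd) h)
  let p : ℕ → T := fun n => Nat.rec ⟨1, h1⟩ (fun n q => ⟨q.1 * g n q, hg' n q⟩) n
  have hp : ∀ n, (p n).1 = ∏ i ∈ Finset.range n, g i (p i) := by
    intro n
    induction n with
    | zero => rfl
    | succ n ih => rw [Finset.prod_range_succ, ← ih]
  refine ⟨fun n => g n (p n), fun n => hg n (p n), fun n hn => (p n).2 ?_⟩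
  refine localizingSystem_mono (fun d _ => mem_conductor_ofIdeal.2 ?_)
    top_mem_localizingSystem
  rw [hp]
  exact A.mul_mem_left d hn

/-- Each prime in `F` contributes some `j n` to a multiplicative set that misses `A`; a prime over
`A` disjoint from that set cannot be in `F`. -/
theorem exists_mem_quasiSpec_of_isRadical [Countable (PrimeSpectrum D)] (hst : star.IsStable)
    {A : Ideal D} (hA : A ∉ star.localizingSystem) (hrad : A.IsRadical) :
    ∃ P ∈ star.quasiSpec, A ≤ P.asIdeal := by
  classical
  obtain ⟨f, hf⟩ := exists_surjective_nat (PrimeSpectrum D)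
  obtain ⟨j, hj, hjA⟩ := exists_seq_prod_notMem hst hA
    (fun n => if f n ∈ star.quasiSpec then ⊤ else (f n).asIdeal) (fun n => by
      split_ifs with h
      · exact top_mem_localizingSystem
      · rwa [mem_quasiSpec_iff hst, not_not] at h)
  let p : ℕ → D := fun n => ∏ i ∈ Finset.range n, j i
  have hp : ∀ {m n : ℕ}, m ≤ n → p m ∣ p n := fun h =>
    Finset.prod_dvd_prod_of_subset _ _ _ (Finset.range_mono h)
  -- Closing under divisors puts every single `j n` in `S`; radicality of `A` handles the powers.
  let S : Submonoid D :=
    { carrier := {d | ∃ n k, d ∣ p n ^ k}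
      one_mem' := ⟨0, 0, one_dvd _⟩
      mul_mem' := by
        rintro d e ⟨m, k, hd⟩ ⟨n, l, he⟩
        refine ⟨max m n, k + l, ?_⟩
        rw [pow_add]
        exact mul_dvd_mul (hd.trans (pow_dvd_pow_of_dvd (hp (le_max_left _ _)) _))
          (he.trans (pow_dvd_pow_of_dvd (hp (le_max_right _ _)) _)) }
  obtain ⟨P, hP, hAP, hdis⟩ := Ideal.exists_le_prime_disjoint A S <| by
    rw [Set.disjoint_left]
    rintro d hd ⟨n, k, h⟩
    exact hjA n (hrad ⟨k, A.mem_of_dvd h hd⟩)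
  obtain ⟨n, hn⟩ := hf ⟨P, hP⟩
  refine ⟨⟨P, hP⟩, ?_, hAP⟩
  by_contra hPq
  have hjn := hj n
  rw [hn, if_neg hPq] at hjn
  refine Set.disjoint_left.1 hdis hjn ⟨n + 1, 1, ?_⟩
  rw [pow_one]
  exact Finset.dvd_prod_of_mem _ (Finset.self_mem_range_succ n)

/-- Otherwise choose `j n` in the saturation at the `n`th prime. The union `B` of the `(A : p n)` is
proper, yet at a maximal ideal `M ⊇ B` some `s ∉ M` satisfies `s * j n ∈ A`, so `s ∈ B`. -/
theorem exists_saturation_notMem [Countable (PrimeSpectrum D)] (hst : star.IsStable)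
    {A : Ideal D} (hA : A ∉ star.localizingSystem) :
    ∃ P : PrimeSpectrum D, A ≤ P.asIdeal ∧ saturation K P A ∉ star.localizingSystem := by
  by_contra! hcon
  obtain ⟨f, hf⟩ := exists_surjective_nat (PrimeSpectrum D)
  obtain ⟨j, hj, hjA⟩ := exists_seq_prod_notMem hst hA (fun n => saturation K (f n) A)
    (fun n => by
      by_cases h : A ≤ (f n).asIdeal
      · exact hcon _ h
      · rw [saturation_eq_top h]
        exact top_mem_localizingSystem)
  let p : ℕ → D := fun n => ∏ i ∈ Finset.range n, j i
  have hp : ∀ {m n : ℕ}, m ≤ n → p m ∣ p n := fun h =>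
    Finset.prod_dvd_prod_of_subset _ _ _ (Finset.range_mono h)
  let B : Ideal D :=
    { carrier := {d | ∃ n, p n * d ∈ A}
      zero_mem' := ⟨0, by simp⟩
      add_mem' := by
        rintro d e ⟨m, hd⟩ ⟨n, he⟩
        refine ⟨max m n, ?_⟩
        rw [mul_add]
        exact A.add_mem (A.mem_of_dvd (mul_dvd_mul_right (hp (le_max_left _ _)) d) hd)
          (A.mem_of_dvd (mul_dvd_mul_right (hp (le_max_right _ _)) e) he)
      smul_mem' := by
        rintro c d ⟨n, hd⟩
        refine ⟨n, ?_⟩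
        rw [smul_eq_mul, mul_left_comm]
        exact A.mul_mem_left c hd }
  have hB : B ≠ ⊤ := by
    rw [Ideal.ne_top_iff_one]
    rintro ⟨n, hn⟩
    rw [mul_one] at hn
    exact hjA n hn
  obtain ⟨M, hM, hBM⟩ := Ideal.exists_le_maximal B hB
  obtain ⟨n, hn⟩ := hf ⟨M, hM.isPrime⟩
  obtain ⟨s, hs, hsj⟩ := mem_saturation.1 (hj n)
  rw [hn] at hs
  refine hs (hBM ⟨n + 1, A.mem_of_dvd ?_ hsj⟩)
  rw [mul_comm]
  exact mul_dvd_mul_right (Finset.dvd_prod_of_mem _ (Finset.self_mem_range_succ n)) s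

theorem IsRadical.isSpectral [Countable (PrimeSpectrum D)] (h : star.IsRadical) :
    star.IsSpectral := by
  refine ⟨star.quasiSpec, fun I => le_antisymm ?_ fun x hx => ?_⟩
  · exact le_iInf₂ fun P hP x hx => mem_extendAt_of_mem_star h.2 hP hx
  · rw [mem_star_iff h.2]
    by_contra hA
    obtain ⟨P, hP, hle⟩ := exists_mem_quasiSpec_of_isRadical h.2 (h.1 _ hA)
      (Ideal.radical_isRadical _)
    simp only [spectralMap, Submodule.mem_iInf] at hx
    exact mem_extendAt_iff_conductor_not_le.1 (hx P hP) (Ideal.le_radical.trans hle)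

theorem mem_pseudoSpec_of_saturation_notMem (hst : star.IsStable) {Q : PrimeSpectrum D}
    {A : Ideal D} (hQ : Q.asIdeal ∈ star.localizingSystem) (hmin : Q.asIdeal ∈ A.minimalPrimes)
    (hA : saturation K Q A ∉ star.localizingSystem) : Q ∈ star.pseudoSpec := by
  set L := saturation K Q A with hL
  have hle : L ≤ contract (star (ofIdeal K L)) := fun a ha =>
    star.le_closure' _ (algebraMap_mem_ofIdeal.2 ha)
  -- The primary quasi-ideal is `L^⋆ ∩ D`. It lies in `Q` because `d ∉ Q` forces `(L : d) ≤ L`,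
  -- which is not in `F`.
  obtain ⟨h1, h2⟩ := isPrimary_of_forall_mul_mem (P := Q) (L := contract (star (ofIdeal K L)))
    (fun d hd => by
      by_contra hdQ
      refine hA (localizingSystem_mono (fun e he => ?_) ((mem_star_iff hst).1 hd))
      refine saturation_saturation hdQ ?_
      rw [mul_comm]
      exact mem_conductor_ofIdeal.1 he)
    ((le_radical_saturation_of_mem_minimalPrimes hmin).trans (Ideal.radical_mono hle))
    (fun s hs d hd => (mem_star_iff hst).2 (localizingSystem_mono (fun e he => by
      have he := mem_conductor_ofIdeal.1 he
      rw [mul_left_comm] at he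
      exact mem_conductor_ofIdeal.2 (saturation_saturation hs he)) ((mem_star_iff hst).1 hd)))
  refine ⟨hQ, _, h1, h2, le_antisymm (fun a ha => ?_) fun a ha => ?_⟩
  · exact star.le_closure' _ (algebraMap_mem_ofIdeal.2 ha)
  · have hsub : ofIdeal K (contract (star (ofIdeal K L))) ≤ star (ofIdeal K L) := by
      rintro _ ⟨d, hd, rfl⟩
      exact hd
    have := star.monotone' _ _ hsub ha
    rwa [star.idempotent'] at this

end Stable

/-! ### Prüfer domains and the normalized stable version -/

section Prufer

variable {D : Type u} [CommRing D] [IsDomain D]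
  {K : Type v} [Field K] [Algebra D K] [IsFractionRing D K]
  {star : SemistarOperation D K}

/-- `D_P` is a valuation ring. If `J` inverts `(a, b)` and no `t` works, all `a * y` and `b * y`
with `y ∈ J` lie in `P`, hence so does `1`. -/
theorem _root_.IsPruferDomain.exists_dvd_mul (hD : IsPruferDomain D) (P : PrimeSpectrum D)
    (a b : D) : ∃ t ∉ P.asIdeal, a ∣ t * b ∨ b ∣ t * a := by
  by_cases h0 : Ideal.span {a, b} = ⊥
  · have hb : b = 0 := (Submodule.eq_bot_iff _).1 h0 b (Ideal.subset_span (by simp))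
    exact ⟨1, fun h => P.2.ne_top ((Ideal.eq_top_iff_one _).2 h), Or.inl (by simp [hb])⟩
  obtain ⟨J, hJ⟩ := (hD _ (Submodule.fg_span (Set.toFinite _)) h0).exists_right_inv
  have hint : ∀ c ∈ ({a, b} : Set D), ∀ y ∈ J,
      ∃ d : D, algebraMap D (FractionRing D) d = algebraMap D (FractionRing D) c * y := by
    intro c hc y hy
    have := FractionalIdeal.mul_mem_mul
      (FractionalIdeal.mem_coeIdeal_of_mem D⁰ (Ideal.subset_span hc)) hy
    rw [hJ] at this
    exact (FractionalIdeal.mem_one_iff _).1 this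
  have hinj := IsFractionRing.injective D (FractionRing D)
  have hone : (1 : FractionRing D) ∈
      (Ideal.span {a, b} : FractionalIdeal D⁰ (FractionRing D)) * J := by
    rw [hJ]
    exact FractionalIdeal.one_mem_one _
  by_contra! hcon
  have key : ∀ y ∈ J, ∀ c ∈ ({a, b} : Set D), ∀ d : D,
      algebraMap D (FractionRing D) d = algebraMap D (FractionRing D) c * y → d ∈ P.asIdeal := by
    intro y hy c hc d hd
    by_contra hdP
    rcases hc with rfl | rfl
    · obtain ⟨e, he⟩ := hint b (by simp) y hy
      refine (hcon d hdP).1 ⟨e, hinj ?_⟩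
      rw [map_mul, map_mul, hd, he]
      ring
    · obtain ⟨e, he⟩ := hint a (by simp) y hy
      refine (hcon d hdP).2 ⟨e, hinj ?_⟩
      rw [map_mul, map_mul, hd, he]
      ring
  have hmem : ∃ d ∈ P.asIdeal, algebraMap D (FractionRing D) d = 1 := by
    refine FractionalIdeal.mul_induction_on hone (fun i hi y hy => ?_) ?_
    · obtain ⟨c, hc, rfl⟩ := (FractionalIdeal.mem_coeIdeal _).1 hi
      obtain ⟨u, v, rfl⟩ := Ideal.mem_span_pair.1 hc
      obtain ⟨d, hd⟩ := hint a (by simp) y hy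
      obtain ⟨e, he⟩ := hint b (by simp) y hy
      refine ⟨u * d + v * e, P.asIdeal.add_mem (P.asIdeal.mul_mem_left _ (key y hy a (by simp) d hd))
        (P.asIdeal.mul_mem_left _ (key y hy b (by simp) e he)), ?_⟩
      simp only [map_add, map_mul, hd, he]
      ring
    · rintro _ _ ⟨d, hd, rfl⟩ ⟨e, he, rfl⟩
      exact ⟨d + e, P.asIdeal.add_mem hd he, map_add _ _ _⟩
  obtain ⟨d, hd, h1⟩ := hmem
  rw [hinj (h1.trans (map_one _).symm)] at hd
  exact P.2.ne_top ((Ideal.eq_top_iff_one _).2 hd)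

theorem mem_locAt_or_exists_smul_eq (hD : IsPruferDomain D) (P : PrimeSpectrum D) (z : K) :
    z ∈ locAt K P ∨ ∃ t ∉ P.asIdeal, ∃ e : D, e • z = algebraMap D K t := by
  obtain ⟨a, b, hb, rfl⟩ := IsFractionRing.div_surjective (A := D) z
  have hb0 : algebraMap D K b ≠ 0 := by
    rw [Ne, FaithfulSMul.algebraMap_eq_zero_iff]
    exact nonZeroDivisors.ne_zero hb
  obtain ⟨t, ht, ⟨e, he⟩ | ⟨e, he⟩⟩ := hD.exists_dvd_mul P a b
  · refine Or.inr ⟨t, ht, e, ?_⟩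
    have := congrArg (algebraMap D K) he
    rw [map_mul, map_mul] at this
    rw [Algebra.smul_def, ← mul_div_assoc, div_eq_iff hb0, this, mul_comm]
  · refine Or.inl (mem_locAt_of_smul_eq ht (a := e) ?_)
    have := congrArg (algebraMap D K) he
    rw [map_mul, map_mul] at this
    rw [Algebra.smul_def, ← mul_div_assoc, div_eq_iff hb0, this, mul_comm]

/-- In the valuation ring `D_P`, elements of `Q` are divisible by elements outside `Q`. -/
theorem mul_saturation_le (hD : IsPruferDomain D) {P Q : PrimeSpectrum D}
    (h : Q.asIdeal ≤ P.asIdeal) (A : Ideal D) :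
    Q.asIdeal * saturation K Q A ≤ saturation K P A := by
  rw [Ideal.mul_le]
  intro q hq y hy
  obtain ⟨s, hs, hsy⟩ := mem_saturation.1 hy
  obtain ⟨t, ht, ⟨w, hw⟩ | ⟨w, hw⟩⟩ := hD.exists_dvd_mul P s q
  · refine mem_saturation.2 ⟨t, ht, ?_⟩
    rw [← mul_assoc, hw, mul_right_comm]
    exact A.mul_mem_right w hsy
  · exact absurd (hw ▸ Q.asIdeal.mul_mem_right w hq) (Q.2.mul_notMem (fun h' => ht (h h')) hs)

/-- If `z ∉ D_Q`, then `z⁻¹ = e / t` with `e ∈ Q`, and the conductor is inside `e D_Q ∩ D`. As `e ^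
n ∈ L` for some `n`, its `n`th power lies in `L`, forcing `L ∈ F` although `L` is a proper
quasi-ideal. -/
theorem mem_locAt_of_conductor_mem (hD : IsPruferDomain D) (hst : star.IsStable)
    {Q : PrimeSpectrum D} (hQ : Q ∈ star.pseudoSpec) {z : K}
    (hz : conductor (locAt K Q) z ∈ star.localizingSystem) : z ∈ locAt K Q := by
  obtain ⟨-, L, hL, hLQ, hLq⟩ := hQ
  rcases mem_locAt_or_exists_smul_eq hD Q z with hzQ | ⟨t, ht, e, he⟩
  · exact hzQ
  by_cases heQ : e ∈ Q.asIdeal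
  swap
  · exact mem_locAt_of_smul_eq heQ he
  exfalso
  rw [← hLQ] at heQ
  obtain ⟨n, hn⟩ := heQ
  have hle : conductor (locAt K Q) z ≤ saturation K Q (Ideal.span {e}) := by
    intro d hd
    obtain ⟨s, hs, a, ha⟩ := mem_locAt.1 (mem_conductor.1 hd)
    refine mem_saturation.2 ⟨s * t, Q.2.mul_notMem hs ht, Ideal.mem_span_singleton.2 ⟨a, ?_⟩⟩
    apply IsFractionRing.injective D K
    simp only [map_mul, ← ha, ← he, Algebra.smul_def]
    ring
  have hsat : saturation K Q L ≤ L := by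
    intro d hd
    obtain ⟨s, hs, hsd⟩ := mem_saturation.1 hd
    rw [mul_comm] at hsd
    refine ((Ideal.isPrimary_iff.1 hL).2 hsd).resolve_right ?_
    rwa [hLQ]
  have hpow : conductor (locAt K Q) z ^ n ≤ L := by
    refine ((Ideal.pow_right_mono hle n).trans (saturation_pow_le n)).trans
      (le_trans (saturation_mono ?_) hsat)
    rw [Ideal.span_singleton_pow, Ideal.span_singleton_le_iff_mem]
    exact hn
  have hLF : L ∈ star.localizingSystem :=
    localizingSystem_mono hpow (pow_mem_localizingSystem hst hz n)
  refine (Ideal.isPrimary_iff.1 hL).1 ((Ideal.eq_top_iff_one _).2 ?_)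
  have hLq' : L = contract (star (ofIdeal K L)) := hLq
  rw [hLq', mem_contract, map_one]
  exact hLF

theorem le_normalizedStable (hD : IsPruferDomain D) (hst : star.IsStable) (I : Submodule D K) :
    star I ≤ star.normalizedStable I := by
  refine le_inf (le_iInf₂ fun P hP x hx => mem_extendAt_of_mem_star hst hP hx)
    (le_iInf₂ fun Q hQ x hx => Submodule.mem_div_iff_forall_mul_mem.2 fun y hy => ?_)
  refine mem_locAt_of_conductor_mem hD hst hQ
    (localizingSystem_mono (fun d hd => ?_) ((mem_star_iff hst).1 hx))
  have hdx : d • x ∈ extendAt Q I :=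
    mem_extendAt.2 ⟨1, fun h => Q.2.ne_top ((Ideal.eq_top_iff_one _).2 h), by rwa [one_smul]⟩
  have := Submodule.mem_div_iff_forall_mul_mem.1 hy _ hdx
  rwa [mul_smul_comm, mul_comm] at this

/-- If the conductor `(I : x)` does not generate an ideal containing `Q` in the valuation ring
`D_Q`, then `x` is not in the divisorial closure of `I D_Q`. -/
theorem notMem_divisorialClosure (hD : IsPruferDomain D) {Q : PrimeSpectrum D}
    {I : Submodule D K} {x : K} (h : ¬ Q.asIdeal ≤ saturation K Q (conductor I x)) :
    x ∉ divisorialClosure (locAt K Q) (extendAt Q I) := by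
  obtain ⟨q, hq, hqA⟩ := SetLike.not_le_iff_exists.1 h
  have hq0 : algebraMap D K q ≠ 0 := by
    rw [Ne, FaithfulSMul.algebraMap_eq_zero_iff]
    rintro rfl
    exact hqA (zero_mem _)
  have hx : x ≠ 0 := by
    rintro rfl
    refine hqA (mem_saturation.2 ⟨1, fun h => Q.2.ne_top ((Ideal.eq_top_iff_one _).2 h), ?_⟩)
    rw [mem_conductor, smul_zero]
    exact zero_mem _
  intro hmem
  -- `q * x ∉ I D_Q`, so `I D_Q ⊆ q x D_Q` by the valuation property; `x ∈ q x D_Q` would then make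
  -- `q ∈ Q` a unit of `D_Q`.
  have hy : (algebraMap D K q * x)⁻¹ ∈ locAt K Q / extendAt Q I := by
    refine Submodule.mem_div_iff_forall_mul_mem.2 fun w hw => ?_
    obtain ⟨s, hs, hsw⟩ := mem_extendAt.1 hw
    rcases mem_locAt_or_exists_smul_eq hD Q ((algebraMap D K q * x)⁻¹ * w) with h' | ⟨t, ht, e, he⟩
    · exact h'
    · refine absurd (mem_saturation.2 ⟨s * t, Q.2.mul_notMem hs ht, ?_⟩) hqA
      have hwe : e • s • w = (s * t * q) • x := by
        simp only [Algebra.smul_def, map_mul] at he ⊢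
        rw [← he]
        field_simp
      rw [mem_conductor, ← hwe]
      exact I.smul_mem e hsw
  have h1 := Submodule.mem_div_iff_forall_mul_mem.1 hmem _ hy
  obtain ⟨s, hs, a, ha⟩ := mem_locAt.1 h1
  refine hs ?_
  have hsa : s = a * q := by
    apply IsFractionRing.injective D K
    rw [map_mul, ← ha, Algebra.smul_def]
    field_simp
  rw [hsa]
  exact Q.asIdeal.mul_mem_left a hq

theorem normalizedStable_le [Countable (PrimeSpectrum D)] (hD : IsPruferDomain D)
    (hst : star.IsStable) (I : Submodule D K) : star.normalizedStable I ≤ star I := by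
  intro x hx
  simp only [normalizedStable, Submodule.mem_inf, Submodule.mem_iInf] at hx
  obtain ⟨hspec, hps⟩ := hx
  rw [mem_star_iff hst]
  by_contra hA
  obtain ⟨P, hAP, hPsat⟩ := exists_saturation_notMem hst hA
  obtain ⟨q, hq, hqP⟩ := Ideal.exists_minimalPrimes_le hAP
  obtain ⟨Q, rfl⟩ : ∃ Q : PrimeSpectrum D, Q.asIdeal = q := ⟨⟨q, hq.1.1⟩, rfl⟩
  have hQ : Q.asIdeal ∈ star.localizingSystem := by
    by_contra hQ
    exact mem_extendAt_iff_conductor_not_le.1 (hspec Q ((mem_quasiSpec_iff hst).2 hQ)) hq.1.2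
  -- Passes from `P` down to `Q`: `F` is closed under products.
  have hQsat : saturation K Q (conductor I x) ∉ star.localizingSystem := fun h =>
    hPsat (localizingSystem_mono (mul_saturation_le hD hqP _) (mul_mem_localizingSystem hst hQ h))
  exact notMem_divisorialClosure hD (fun h => hQsat (localizingSystem_mono h hQ))
    (hps Q (mem_pseudoSpec_of_saturation_notMem hst hQ hq hQsat))

end Prufer

end SemistarOperation

theorem mainTheorem8 (D : Type u) [CommRing D] [IsDomain D]
    (K : Type v) [Field K] [Algebra D K] [IsFractionRing D K]
    (hD : Countable (PrimeSpectrum D)) :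
    (∀ star : SemistarOperation D K, star.IsRadical → star.IsSpectral) ∧
    (IsPruferDomain D →
      ∀ star : SemistarOperation D K, star.IsStable →
        ∀ I : Submodule D K, star I = star.normalizedStable I) :=
  ⟨fun _ h => h.isSpectral, fun hP _ hst I => le_antisymm
    (SemistarOperation.le_normalizedStable hP hst I)
    (SemistarOperation.normalizedStable_le hP hst I)⟩
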